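/- Let $d\ge 1$ be an integer. For a finite set $C\subset\mathbb Z^d$ let $$\Theta_d(C):=\{(x,y)\in\mathbb Z^d\times\mathbb Z^d:\ |x-y|=1,\ x\in C,\ y\in\mathbb Z^d\setminus C\}$$ be its edge boundary, where $|\cdot|$ is the Euclidean norm, and for $n\in\mathbb N$ let $EIP^d(n):=\min\{\#\Theta_d(C):\ C\subset\mathbb Z^d,\ \#C=n\}$. A nonempty finite set $C\subset\mathbb Z^d$ is called an $EIP^d$ minimizer if $\#\Theta_d(C)=EIP^d(\#C)$; by convention, the empty set is an $EIP^d$ minimizer as well. The same definitions are used in dimension $0$, where $\mathbb Z^0$ is a single point. For $s\in\{1,\dots,d\}$ and $k\in\mathbb Z$ the $(d-1)$-dimensional section of $C$ is $S_{s,k}(C):=\{x\in C:\ x_s=k\}$; it is identified with a subset of $\mathbb Z^{d-1}$ by deleting the $s$-th coordinate. If $C\subset\mathbb Z^d$ is an $EIP^d$ minimizer, then for every $s\in\{1,\dots,d\}$ and every $k\in\mathbb Z$ the section $S_{s,k}(C)$, regarded as a subset of $\mathbb Z^{d-1}$, is an $EIP^{d-1}$ minimizer. -/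

import Mathlib

namespace EdgeIso

/-- The edge boundary `Θ_d(C)`: ordered pairs `(x, y)` of lattice points at Euclidean distance `1`
(equivalently, squared distance `1`) with `x ∈ C` and `y ∉ C`. -/
def edgeBoundary {d : ℕ} (C : Set (Fin d → ℤ)) : Set ((Fin d → ℤ) × (Fin d → ℤ)) :=
  {p | ∑ i, (p.1 i - p.2 i) ^ 2 = 1 ∧ p.1 ∈ C ∧ p.2 ∉ C}

/-- The edge perimeter `#Θ_d(C)`. The edge boundary of a finite set is finite, so that `Set.ncard`
is the genuine cardinality wherever it is used below. -/
noncomputable def edgePerimeter {d : ℕ} (C : Set (Fin d → ℤ)) : ℕ :=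
  (edgeBoundary C).ncard

/-- `EIP^d(n)`: the minimal edge perimeter among the `n`-point subsets of `ℤ^d`. The infimum of a
nonempty set of natural numbers is its minimum. -/
noncomputable def EIP (d n : ℕ) : ℕ :=
  sInf {m : ℕ | ∃ C : Set (Fin d → ℤ), C.Finite ∧ C.ncard = n ∧ edgePerimeter C = m}

/-- `EIP^d` minimizers: the empty set, and the nonempty finite sets `C ⊆ ℤ^d` whose edge perimeter
equals `EIP^d(#C)`. -/
def IsEIPMinimizer {d : ℕ} (C : Set (Fin d → ℤ)) : Prop :=
  C = ∅ ∨ (C.Nonempty ∧ C.Finite ∧ edgePerimeter C = EIP d C.ncard)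

/-- The section `S_{s,k}(C) = {x ∈ C : e_s · x = k}`. -/
def latticeSection {d : ℕ} (C : Set (Fin d → ℤ)) (s : Fin d) (k : ℤ) : Set (Fin d → ℤ) :=
  {x ∈ C | x s = k}

/-- The map `ℤ^(d+1) → ℤ^d` that deletes the coordinate `s`; it identifies each hyperplane
`{x : x s = k}` with `ℤ^d`. -/
def dropCoord {d : ℕ} (s : Fin (d + 1)) (x : Fin (d + 1) → ℤ) : Fin d → ℤ :=
  fun i => x (s.succAbove i)

end EdgeIso

/-! Sections are compressed against a nested family of minimizers, `chain d`, one of each possible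
size. Replacing every section of C orthogonal to s by the chain set of equal size increases neither
the perimeters of the sections (minimality) nor the boundary between adjacent ones (nestedness,
`card_sdiff_chain_le`). If C is a minimizer, all these inequalities are equalities, so each section
was already minimal.

The work is the minimality of the chain, `perimeter_chain_le`. The chain completes quasi-cubes B
face by face, filling each face by the chain one dimension lower, so its perimeters satisfy
p_{d+1}(B + t) = p_{d+1}(B) + p_d(t). An n-point set with a^(d+1) < n ≤ (a+1)^(d+1) has more than a
nonempty sections in some direction, hence a nonempty section of r points with (a+1) r ≤ n. Deleting
it and closing the gap saves at least its perimeter (`exists_perimeter_add_slice_le`), so induction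
leaves the numerical claim p_{d+1}(n) ≤ p_{d+1}(n - r) + p_d(r), `LayerRecursion.le_split`. This
follows from the recursion alone, through `LayerRecursion.carry`: pouring one pile into another
until the latter is a full quasi-cube does not increase the total. -/

namespace EdgeIso

/-! ### Sizes of quasi-cubes -/

/-- The number of points of the quasi-cube in `ℤ^d` with `j` sides of length `a + 1` and `d - j`
sides of length `a`. -/
def boxCard (d a j : ℕ) : ℕ := a ^ (d - j) * (a + 1) ^ j

theorem boxCard_pos {d a j : ℕ} (ha : 1 ≤ a) : 0 < boxCard d a j := by
  unfold boxCard; positivity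

theorem boxCard_zero_right (d a : ℕ) : boxCard d a 0 = a ^ d := by simp [boxCard]

theorem boxCard_self (d a : ℕ) : boxCard d a d = (a + 1) ^ d := by simp [boxCard]

theorem boxCard_succ_eq_mul {d a j : ℕ} (hj : j ≤ d) :
    boxCard (d + 1) a j = a * boxCard d a j := by
  unfold boxCard
  rw [Nat.succ_sub hj, pow_succ]; ring

theorem boxCard_succ_succ_eq_mul (d a j : ℕ) :
    boxCard (d + 1) a (j + 1) = (a + 1) * boxCard d a j := by
  unfold boxCard
  rw [Nat.succ_sub_succ, pow_succ (a + 1)]; ring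

theorem boxCard_succ_succ {d a j : ℕ} (hj : j ≤ d) :
    boxCard (d + 1) a (j + 1) = boxCard (d + 1) a j + boxCard d a j := by
  rw [boxCard_succ_eq_mul hj, boxCard_succ_succ_eq_mul]; ring

theorem boxCard_mono_right {d a i j : ℕ} (hij : i ≤ j) (hj : j ≤ d) :
    boxCard d a i ≤ boxCard d a j := by
  unfold boxCard
  obtain ⟨k, rfl⟩ := Nat.exists_eq_add_of_le hij
  have h : d - i = (d - (i + k)) + k := by omega
  rw [h, pow_add, pow_add, mul_assoc, mul_comm (a ^ k)]
  gcongr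
  omega

theorem boxCard_le_succ_pow {d a j : ℕ} (hj : j ≤ d) : boxCard d a j ≤ (a + 1) ^ d :=
  boxCard_self d a ▸ boxCard_mono_right hj le_rfl

theorem pow_le_boxCard {d a j : ℕ} (hj : j ≤ d) : a ^ d ≤ boxCard d a j :=
  boxCard_zero_right d a ▸ boxCard_mono_right (Nat.zero_le j) hj

theorem boxCard_le_of_lt {d a a' j j' : ℕ} (h : a' < a) (hj : j ≤ d) (hj' : j' ≤ d) :
    boxCard d a' j' ≤ boxCard d a j :=
  (boxCard_le_succ_pow hj').trans ((Nat.pow_le_pow_left h d).trans (pow_le_boxCard hj))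

/-- Quasi-cubes are linearly ordered by their cardinalities, in the lexicographic order of their
parameters. -/
theorem lex_of_boxCard_lt {d a a' j j' : ℕ} (hj : j ≤ d) (hj' : j' ≤ d)
    (h : boxCard (d + 1) a' j' < boxCard (d + 1) a (j + 1)) : a' < a ∨ (a' = a ∧ j' ≤ j) := by
  by_contra hcon
  apply absurd h
  rw [not_lt]
  rcases lt_trichotomy a a' with h1 | h1 | h1
  · exact boxCard_le_of_lt h1 (by omega) (by omega)
  · subst h1
    exact boxCard_mono_right (by omega) (by omega)
  · omega

/-- The lexicographic order of the parameters orders the faces as well. Hence a layer of a smaller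
pile fits the face being filled in `LayerRecursion.carry_face`. -/
theorem face_le_of_boxCard_lt {d a a' j j' : ℕ} (hj : j ≤ d) (hj' : j' ≤ d)
    (h : boxCard (d + 1) a' j' < boxCard (d + 1) a (j + 1)) :
    boxCard d a' j' ≤ boxCard d a j := by
  rcases lex_of_boxCard_lt hj hj' h with h1 | ⟨rfl, h1⟩
  · exact boxCard_le_of_lt h1 hj hj'
  · exact boxCard_mono_right h1 hj

/-- Every quasi-cube other than a point arises from a smaller one by adding a full face. -/
theorem exists_boxCard_pred {d a j : ℕ} (ha : 1 ≤ a) (hj : j ≤ d + 1) (h : ¬(a = 1 ∧ j = 0)) :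
    ∃ a' j', 1 ≤ a' ∧ j' ≤ d ∧ ((a = a' ∧ j = j' + 1) ∨ (a = a' + 1 ∧ j = 0 ∧ j' = d)) ∧
      boxCard (d + 1) a j = boxCard (d + 1) a' (j' + 1) := by
  rcases Nat.eq_zero_or_pos j with rfl | hj0
  · refine ⟨a - 1, d, by omega, le_rfl, Or.inr ⟨by omega, rfl, rfl⟩, ?_⟩
    rw [boxCard_zero_right, boxCard_self]
    congr 1; omega
  · obtain ⟨i, rfl⟩ : ∃ i, j = i + 1 := ⟨j - 1, by omega⟩
    exact ⟨a, i, ha, by omega, Or.inl ⟨rfl, rfl⟩, rfl⟩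

/-- Every `n ≥ 2` is a quasi-cube plus a nonempty part of its next face. -/
theorem exists_stage (d : ℕ) {n : ℕ} (hn : 2 ≤ n) :
    ∃ a j t, 1 ≤ a ∧ j ≤ d ∧ 0 < t ∧ t ≤ boxCard d a j ∧ n = boxCard (d + 1) a j + t := by
  induction n, hn using Nat.le_induction with
  | base =>
    refine ⟨1, 0, 1, le_rfl, Nat.zero_le d, one_pos, ?_, ?_⟩ <;> simp [boxCard]
  | succ n hn ih =>
    obtain ⟨a, j, t, ha, hj, ht, htF, rfl⟩ := ih
    by_cases h : t < boxCard d a j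
    · exact ⟨a, j, t + 1, ha, hj, by omega, h, by ring⟩
    · have ht' : t = boxCard d a j := by omega
      have key := boxCard_succ_succ (a := a) hj
      rcases hj.lt_or_eq with hlt | rfl
      · exact ⟨a, j + 1, 1, ha, hlt, one_pos, boxCard_pos ha, by omega⟩
      · refine ⟨a + 1, 0, 1, by omega, Nat.zero_le _, one_pos, boxCard_pos (by omega), ?_⟩
        rw [boxCard_self] at key
        rw [boxCard_zero_right (j + 1)]
        omega

/-- The decomposition of `exists_stage` is unique. -/
theorem stage_unique {d a a' j j' t t' : ℕ} (hj : j ≤ d) (hj' : j' ≤ d) (ht : 0 < t)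
    (ht' : 0 < t') (htF : t ≤ boxCard d a j) (htF' : t' ≤ boxCard d a' j')
    (h : boxCard (d + 1) a j + t = boxCard (d + 1) a' j' + t') : a = a' ∧ j = j' ∧ t = t' := by
  have k1 := boxCard_succ_succ (a := a) hj
  have k2 := boxCard_succ_succ (a := a') hj'
  have h1 := lex_of_boxCard_lt (a := a) (a' := a') hj hj' (by omega)
  have h2 := lex_of_boxCard_lt (a := a') (a' := a) hj' hj (by omega)
  have ha : a = a' := by omega
  have hjj : j = j' := by omega
  subst ha hjj
  exact ⟨rfl, rfl, by omega⟩

/-! ### Numerical inequalities from the layer recursion -/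

/-- A family of functions that satisfies the recursion of the perimeters of the nested quasi-cubes
completed by nested subsets of their faces. -/
structure LayerRecursion (p : ℕ → ℕ → ℕ) : Prop where
  zero_left : ∀ n, p 0 n = 0
  zero_right : ∀ d, p d 0 = 0
  one_right : ∀ d, p (d + 1) 1 = p d 1 + 2
  layer : ∀ d a j t, 1 ≤ a → j ≤ d → t ≤ boxCard d a j →
    p (d + 1) (boxCard (d + 1) a j + t) = p (d + 1) (boxCard (d + 1) a j) + p d t

/-- The inequality for addition with a carry at quasi-cubes. -/
def CarryInequality (p : ℕ → ℕ → ℕ) (d : ℕ) : Prop :=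
  ∀ a j t r, 1 ≤ a → j ≤ d → t ≤ boxCard d a j → r ≤ boxCard d a j →
    p d (min (boxCard d a j) (t + r)) + p d (t + r - boxCard d a j) ≤ p d t + p d r

variable {p : ℕ → ℕ → ℕ}

/-- A d-dimensional face holding t points is filled from a (d+1)-dimensional pile of r points, one
top layer of the pile at a time. Each transfer is an instance of the d-dimensional inequality. -/
theorem LayerRecursion.carry_face (hp : LayerRecursion p) {d : ℕ} (hK : CarryInequality p d)
    {a j t : ℕ} (ha : 1 ≤ a) (hj : j ≤ d) (ht : t ≤ boxCard d a j) (r : ℕ)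
    (hr : r ≤ boxCard (d + 1) a (j + 1)) :
    p d (min (boxCard d a j) (t + r)) + p (d + 1) (t + r - boxCard d a j) ≤
      p d t + p (d + 1) r := by
  induction r using Nat.strong_induction_on generalizing t with
  | _ r ih =>
  have hpos := boxCard_pos (d := d) (j := j) ha
  set F := boxCard d a j with hF
  rcases Nat.lt_or_ge r 2 with h2 | h2
  · obtain rfl | rfl : r = 0 ∨ r = 1 := by omega
    · simp [ht, Nat.sub_eq_zero_of_le ht, hp.zero_right]
    · have h := hK a j t 1 ha hj ht hpos
      rw [← hF] at h
      rcases ht.lt_or_eq with hlt | heq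
      · have e : t + 1 - F = 0 := by omega
        rw [e, hp.zero_right] at h ⊢
        rw [hp.one_right]; omega
      · rw [heq]; simp
  · obtain ⟨a', j', r', ha', hj', hr', hrF', rfl⟩ := exists_stage d h2
    have hface : boxCard d a' j' ≤ F := face_le_of_boxCard_lt hj hj' (by omega)
    have h := hK a j t r' ha hj ht (by omega)
    rw [← hF] at h
    rw [hp.layer d a' j' r' ha' hj' hrF']
    -- Either the top layer r' suffices to fill the face, or it is absorbed entirely and the
    -- remaining quasi-cube is poured by induction.
    rcases le_total F (t + r') with h1 | h1
    · have e : t + (boxCard (d + 1) a' j' + r') - F = boxCard (d + 1) a' j' + (t + r' - F) := by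
        omega
      rw [e, hp.layer d a' j' _ ha' hj' (by omega)]
      rw [min_eq_left h1] at h
      rw [min_eq_left (by omega)]
      omega
    · have h3 := ih (boxCard (d + 1) a' j') (by omega) h1 (by omega)
      have e : t + (boxCard (d + 1) a' j' + r') = t + r' + boxCard (d + 1) a' j' := by omega
      rw [e]
      rw [min_eq_right h1, Nat.sub_eq_zero_of_le h1, hp.zero_right] at h
      omega

/-- The common quasi-cube splits off, so only its next face remains to be filled. -/
theorem LayerRecursion.carry_of_ge (hp : LayerRecursion p) {d : ℕ} (hK : CarryInequality p d)
    {a j t r : ℕ} (ha : 1 ≤ a) (hj : j ≤ d) (hBt : boxCard (d + 1) a j ≤ t)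
    (ht : t ≤ boxCard (d + 1) a (j + 1)) (hr : r ≤ boxCard (d + 1) a (j + 1)) :
    p (d + 1) (min (boxCard (d + 1) a (j + 1)) (t + r)) +
      p (d + 1) (t + r - boxCard (d + 1) a (j + 1)) ≤ p (d + 1) t + p (d + 1) r := by
  obtain ⟨u, rfl⟩ := Nat.exists_eq_add_of_le hBt
  have key := boxCard_succ_succ (a := a) hj
  have hu : u ≤ boxCard d a j := by omega
  have h := hp.carry_face hK ha hj hu r hr
  have e1 : min (boxCard (d + 1) a (j + 1)) (boxCard (d + 1) a j + u + r) =
      boxCard (d + 1) a j + min (boxCard d a j) (u + r) := by omega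
  have e2 : boxCard (d + 1) a j + u + r - boxCard (d + 1) a (j + 1) =
      u + r - boxCard d a j := by omega
  rw [e1, e2, hp.layer d a j _ ha hj (min_le_left _ _), hp.layer d a j _ ha hj hu]
  omega

theorem LayerRecursion.carry_succ (hp : LayerRecursion p) {d : ℕ} (hK : CarryInequality p d) :
    CarryInequality p (d + 1) := by
  intro a j t r ha hj ht hr
  induction hF : boxCard (d + 1) a j using Nat.strong_induction_on generalizing a j t r with
  | _ F ih =>
  subst hF
  by_cases h1 : a = 1 ∧ j = 0
  · obtain ⟨rfl, rfl⟩ := h1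
    have hb : boxCard (d + 1) 1 0 = 1 := by simp [boxCard]
    rw [hb] at ht hr ⊢
    obtain rfl | rfl : t = 0 ∨ t = 1 := by omega
    · simp [hr, Nat.sub_eq_zero_of_le hr, hp.zero_right]
    · simp
  · obtain ⟨a', j', ha', hj', -, e⟩ := exists_boxCard_pred ha hj h1
    rw [e] at ht hr ih ⊢
    have key := boxCard_succ_succ (a := a') hj'
    have hpos := boxCard_pos (d := d) (j := j') ha'
    rcases le_total (boxCard (d + 1) a' j') t with htB | htB
    · exact hp.carry_of_ge hK ha' hj' htB ht hr
    rcases le_total (boxCard (d + 1) a' j') r with hrB | hrB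
    · rw [add_comm t r, add_comm (p (d + 1) t)]
      exact hp.carry_of_ge hK ha' hj' hrB hr ht
    -- Both piles are at most the preceding quasi-cube: first fill that one, then carry what is left
    -- onto its last face.
    have h := ih _ (by omega) a' j' t r ha' (by omega) htB hrB rfl
    rcases le_total (t + r) (boxCard (d + 1) a' j') with hs | hs
    · rw [min_eq_right hs, Nat.sub_eq_zero_of_le hs] at h
      rw [min_eq_right (by omega), Nat.sub_eq_zero_of_le (by omega)]
      exact h
    · rw [min_eq_left hs] at h
      have h2 := hp.carry_of_ge hK ha' hj' le_rfl (by omega)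
        (r := t + r - boxCard (d + 1) a' j') (by omega)
      rw [Nat.add_sub_cancel' hs] at h2
      exact h2.trans h

theorem LayerRecursion.carry (hp : LayerRecursion p) : ∀ d, CarryInequality p d
  | 0 => fun a j t r _ _ _ _ => by simp [hp.zero_left]
  | d + 1 => hp.carry_succ (hp.carry d)

/-- Splitting off a layer that is at most an average one does not decrease the value. -/
theorem LayerRecursion.le_split (hp : LayerRecursion p) (d : ℕ) {a n r : ℕ} (ha : 1 ≤ a)
    (hn : n ≤ (a + 1) ^ (d + 1)) (hr : (a + 1) * r ≤ n) :
    p (d + 1) n ≤ p (d + 1) (n - r) + p d r := by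
  induction d generalizing a n r with
  | zero =>
    rcases Nat.eq_zero_or_pos r with rfl | hr0
    · simp
    have h2 : 2 ≤ n := by nlinarith
    obtain ⟨a', j, t, ha', hj, ht, htF, rfl⟩ := exists_stage 0 h2
    obtain rfl : j = 0 := by omega
    have hr1 : r ≤ 1 := by
      by_contra hcon
      have : (a + 1) * 2 ≤ (a + 1) * r := Nat.mul_le_mul_left _ (by omega)
      have h3 := hr.trans hn
      rw [zero_add, pow_one] at h3
      omega
    rw [Nat.add_sub_assoc (by omega), hp.layer 0 a' 0 t ha' hj htF,
      hp.layer 0 a' 0 (t - r) ha' hj (by omega)]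
    simp [hp.zero_left]
  | succ d ih =>
    rcases Nat.eq_zero_or_pos r with rfl | hr0
    · simp
    have h2 : 2 ≤ n := by nlinarith
    have hK := hp.carry (d + 1)
    obtain ⟨a', j, t, ha', hj, ht, htF, rfl⟩ := exists_stage (d + 1) h2
    have haa : a' ≤ a := by
      by_contra hcon
      have h3 : (a + 1) ^ (d + 2) ≤ a' ^ (d + 2) := Nat.pow_le_pow_left (by omega) _
      have h4 := pow_le_boxCard (d := d + 2) (a := a') (j := j) (by omega)
      exact absurd hn (not_le.2 ((h3.trans h4).trans_lt (Nat.lt_add_of_pos_right ht)))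
    have hr' : (a' + 1) * r ≤ boxCard (d + 2) a' j + t :=
      (Nat.mul_le_mul_right r (by omega)).trans hr
    clear hn hr h2 haa ha a
    have hB := boxCard_succ_eq_mul (d := d + 1) (a := a') hj
    -- With F the current face, n ≤ a'F + F = (a' + 1) F.
    have hrF : r ≤ boxCard (d + 1) a' j := by
      have : (a' + 1) * r ≤ (a' + 1) * boxCard (d + 1) a' j := by
        have : (a' + 1) * boxCard (d + 1) a' j = boxCard (d + 2) a' j + boxCard (d + 1) a' j := by
          rw [hB]; ring
        omega
      exact Nat.le_of_mul_le_mul_left this (by omega)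
    rw [hp.layer (d + 1) a' j t ha' hj htF]
    -- If the removed layer fits in the top layer, the carry inequality without overflow is
    -- subadditivity of p.
    rcases le_or_gt r t with hrt | hrt
    · rw [Nat.add_sub_assoc hrt, hp.layer (d + 1) a' j (t - r) ha' hj (by omega)]
      have h := hK a' j (t - r) r ha' hj (by omega) hrF
      rw [Nat.sub_add_cancel hrt, min_eq_right htF, Nat.sub_eq_zero_of_le htF, hp.zero_right] at h
      omega
    have h10 : ¬(a' = 1 ∧ j = 0) := by
      rintro ⟨rfl, rfl⟩
      simp [boxCard] at hrF
      omega
    obtain ⟨c, i, hc, hi, hci, e⟩ := exists_boxCard_pred (d := d + 1) ha' (by omega) h10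
    have key := boxCard_succ_succ (a := c) hi
    have eB : boxCard (d + 2) a' j = boxCard (d + 2) c i + boxCard (d + 1) c i := e.trans key
    rw [eB, hp.layer (d + 1) c i _ hc hi le_rfl]
    -- Otherwise the last full face G of the quasi-cube is opened too. For r ≤ G, pouring r onto G +
    -- t - r refills G and leaves t.
    rcases le_or_gt r (boxCard (d + 1) c i) with hrG | hrG
    · have e3 : boxCard (d + 2) c i + boxCard (d + 1) c i + t - r =
          boxCard (d + 2) c i + (boxCard (d + 1) c i + t - r) := by omega
      rw [e3, hp.layer (d + 1) c i _ hc hi (by omega)]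
      have h := hK c i (boxCard (d + 1) c i + t - r) r hc hi (by omega) hrG
      rw [Nat.sub_add_cancel (by omega), min_eq_left (by omega), Nat.add_sub_cancel_left] at h
      omega
    obtain ⟨rfl, rfl⟩ : a' = c ∧ j = i + 1 := by
      refine hci.resolve_right ?_
      rintro ⟨rfl, rfl, rfl⟩
      rw [boxCard_zero_right] at hrF
      rw [boxCard_self] at hrG
      omega
    obtain ⟨v, rfl⟩ := Nat.exists_eq_add_of_le hrG.le
    have hid : i ≤ d := by omega
    -- Here r = G + v and the quasi-cube has (a' + 1) G points. After cancelling G, the claim for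
    -- (n, r) becomes the claim for (t, v) one dimension lower.
    have hv : (a' + 1) * v ≤ t := by
      rw [boxCard_succ_succ_eq_mul] at hr'
      have : (a' + 1) * (boxCard (d + 1) a' i + v) =
        (a' + 1) * boxCard (d + 1) a' i + (a' + 1) * v := by ring
      omega
    have hvt : v ≤ t := by nlinarith
    have hvF : v ≤ boxCard d a' i := by
      rw [boxCard_succ_succ hid] at hrF
      omega
    have e3 : boxCard (d + 2) a' i + boxCard (d + 1) a' i + t - (boxCard (d + 1) a' i + v) =
        boxCard (d + 2) a' i + (t - v) := by omega
    rw [e3, hp.layer (d + 1) a' i _ hc hi (by omega), hp.layer d a' i v hc hid hvF]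
    have h := ih hc (htF.trans (boxCard_le_succ_pow hj)) hv
    omega

/-! ### The edge perimeter by directions -/

open Finset

/-- The edge perimeter of a finite set, counted by directions. -/
def perimeter {d : ℕ} (C : Finset (Fin d → ℤ)) : ℕ :=
  ∑ i, (#{x ∈ C | x + Pi.single i 1 ∉ C} + #{x ∈ C | x + Pi.single i (-1) ∉ C})

theorem sum_sq_eq_one_iff {d : ℕ} (z : Fin d → ℤ) :
    ∑ i, z i ^ 2 = 1 ↔ ∃ i, z = Pi.single i 1 ∨ z = Pi.single i (-1) := by
  constructor
  · intro h
    obtain ⟨i, hi⟩ : ∃ i, z i ≠ 0 := by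
      by_contra! hcon
      simp [hcon] at h
    have hsum := Finset.add_sum_erase univ (fun i => z i ^ 2) (mem_univ i)
    have hnn : ∀ k ∈ univ.erase i, 0 ≤ z k ^ 2 := fun k _ => sq_nonneg _
    have h0 := Finset.sum_nonneg hnn
    have h1 : 0 < z i ^ 2 := by positivity
    have hz : z i ^ 2 = 1 := by omega
    have hr : ∑ k ∈ univ.erase i, z k ^ 2 = 0 := by omega
    rw [Finset.sum_eq_zero_iff_of_nonneg hnn] at hr
    have hk : ∀ k, k ≠ i → z k = 0 := fun k hk => by simpa using hr k (by simp [hk])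
    refine ⟨i, ?_⟩
    rcases (sq_eq_sq_iff_eq_or_eq_neg.1 (hz.trans (one_pow 2).symm)) with h | h
    · left
      ext k
      by_cases hki : k = i
      · subst hki; simp [h]
      · simp [hki, hk k hki]
    · right
      ext k
      by_cases hki : k = i
      · subst hki; simp [h]
      · simp [hki, hk k hki]
  · rintro ⟨i, rfl | rfl⟩ <;> simp [Pi.single_apply]

theorem edgePerimeter_coe {d : ℕ} (C : Finset (Fin d → ℤ)) :
    edgePerimeter (C : Set (Fin d → ℤ)) = perimeter C := by
  classical
  let E (ε : ℤ) (i : Fin d) : Finset ((Fin d → ℤ) × (Fin d → ℤ)) :=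
    image (fun x => (x, x + Pi.single i ε)) {x ∈ C | x + Pi.single i ε ∉ C}
  have hcard : ∀ ε i, #(E ε i) = #{x ∈ C | x + Pi.single i ε ∉ C} := fun ε i =>
    card_image_of_injective _ fun x y h => (Prod.ext_iff.1 h).1
  have hmem : ∀ ε i q, q ∈ E ε i ↔ q.2 - q.1 = Pi.single i ε ∧ q.1 ∈ C ∧ q.2 ∉ C := by
    rintro ε i ⟨x, y⟩
    simp only [E, mem_image, mem_filter, Prod.mk.injEq]
    constructor
    · rintro ⟨z, ⟨h1, h2⟩, rfl, rfl⟩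
      exact ⟨by simp, h1, h2⟩
    · rintro ⟨h, h1, h2⟩
      have : y = x + Pi.single i ε := by rw [← h]; simp
      exact ⟨x, ⟨h1, this ▸ h2⟩, rfl, this.symm⟩
  have hset : edgeBoundary (C : Set (Fin d → ℤ)) =
      (univ.biUnion fun i => E 1 i ∪ E (-1) i : Finset _) := by
    ext q
    have h := sum_sq_eq_one_iff (q.2 - q.1)
    have h' : ∑ i, (q.1 i - q.2 i) ^ 2 = ∑ i, (q.2 - q.1) i ^ 2 :=
      sum_congr rfl fun i _ => by simp only [Pi.sub_apply]; ring
    simp only [edgeBoundary, Set.mem_ofPred_eq, h', h, coe_biUnion, Set.mem_iUnion, mem_coe,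
      mem_union, hmem, mem_univ]
    constructor
    · rintro ⟨⟨i, hi⟩, h1, h2⟩
      exact ⟨i, trivial, hi.imp (fun h => ⟨h, h1, h2⟩) (fun h => ⟨h, h1, h2⟩)⟩
    · rintro ⟨i, -, hi | hi⟩
      · exact ⟨⟨i, Or.inl hi.1⟩, hi.2⟩
      · exact ⟨⟨i, Or.inr hi.1⟩, hi.2⟩
  have hne : ∀ {i j : Fin d} {ε η : ℤ}, ε ≠ 0 →
      (Pi.single i ε : Fin d → ℤ) = Pi.single j η → i = j ∧ ε = η := by
    intro i j ε η hε h
    have hi := congrFun h i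
    by_cases hij : i = j
    · subst hij; simpa using hi
    · simp [hij] at hi; exact absurd hi hε
  rw [edgePerimeter, hset, Set.ncard_coe_finset, card_biUnion, perimeter]
  · refine sum_congr rfl fun i _ => ?_
    rw [card_union_of_disjoint, hcard, hcard]
    rw [disjoint_left]
    intro q h1 h2
    rw [hmem] at h1 h2
    have := (hne one_ne_zero (h1.1.symm.trans h2.1)).2
    omega
  · intro i _ j _ hij
    rw [Function.onFun, disjoint_left]
    intro q h1 h2
    simp only [mem_union, hmem] at h1 h2
    apply hij
    rcases h1 with h1 | h1 <;> rcases h2 with h2 | h2 <;>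
      exact (hne (by norm_num) (h1.1.symm.trans h2.1)).1

theorem perimeter_empty (d : ℕ) : perimeter (∅ : Finset (Fin d → ℤ)) = 0 := by
  simp [perimeter]

theorem perimeter_singleton {d : ℕ} (x : Fin d → ℤ) : perimeter {x} = 2 * d := by
  simp [perimeter, filter_singleton, mul_comm]

/-! ### Parallel sections -/

variable {d : ℕ}

/-- The section of `C` in the hyperplane `x s = k`, as a subset of `ℤ^d`. -/
def slice (s : Fin (d + 1)) (k : ℤ) (C : Finset (Fin (d + 1) → ℤ)) : Finset (Fin d → ℤ) :=
  image s.removeNth {x ∈ C | x s = k}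

theorem mem_slice {s : Fin (d + 1)} {k : ℤ} {C : Finset (Fin (d + 1) → ℤ)} {y : Fin d → ℤ} :
    y ∈ slice s k C ↔ s.insertNth k y ∈ C := by
  simp only [slice, mem_image, mem_filter]
  constructor
  · rintro ⟨x, ⟨hx, rfl⟩, rfl⟩
    simpa using hx
  · intro h
    exact ⟨_, ⟨h, by simp⟩, by simp⟩

/-- The finite set with section `A k` in the hyperplane `x s = k` for `k ∈ K`, and no other
points. -/
def ofSlices (s : Fin (d + 1)) (K : Finset ℤ) (A : ℤ → Finset (Fin d → ℤ)) :
    Finset (Fin (d + 1) → ℤ) :=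
  K.biUnion fun k => (A k).image fun y => s.insertNth k y

theorem mem_ofSlices {s : Fin (d + 1)} {K : Finset ℤ} {A : ℤ → Finset (Fin d → ℤ)} {k : ℤ}
    {y : Fin d → ℤ} :
    (s.insertNth k y : Fin (d + 1) → ℤ) ∈ ofSlices s K A ↔ k ∈ K ∧ y ∈ A k := by
  simp only [ofSlices, mem_biUnion, mem_image]
  constructor
  · rintro ⟨k', hk', y', hy', h⟩
    obtain ⟨rfl, rfl⟩ := Fin.insertNth_injective2 h
    exact ⟨hk', hy'⟩
  · rintro ⟨hk, hy⟩
    exact ⟨k, hk, y, hy, rfl⟩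

theorem slice_ofSlices (s : Fin (d + 1)) (K : Finset ℤ) (A : ℤ → Finset (Fin d → ℤ)) (k : ℤ) :
    slice s k (ofSlices s K A) = if k ∈ K then A k else ∅ := by
  ext y
  rw [mem_slice, mem_ofSlices]
  split_ifs with h <;> simp [h]

theorem slice_ofSlices_of_forall {s : Fin (d + 1)} {K : Finset ℤ} {A : ℤ → Finset (Fin d → ℤ)}
    (hA : ∀ k ∉ K, A k = ∅) (k : ℤ) : slice s k (ofSlices s K A) = A k := by
  rw [slice_ofSlices]
  split_ifs with h
  · rfl
  · exact (hA k h).symm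

theorem apply_mem_of_mem_ofSlices {s : Fin (d + 1)} {K : Finset ℤ}
    {A : ℤ → Finset (Fin d → ℤ)} {x : Fin (d + 1) → ℤ} (hx : x ∈ ofSlices s K A) : x s ∈ K := by
  rw [← Fin.insertNth_self_removeNth s x, mem_ofSlices] at hx
  exact hx.1

theorem slice_eq_empty {s : Fin (d + 1)} {K : Finset ℤ} {C : Finset (Fin (d + 1) → ℤ)}
    (hK : ∀ x ∈ C, x s ∈ K) {k : ℤ} (hk : k ∉ K) : slice s k C = ∅ := by
  ext y
  rw [mem_slice]
  simp only [notMem_empty, iff_false]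
  intro h
  exact hk (by simpa using hK _ h)

theorem card_filter_eq_sum_slice {s : Fin (d + 1)} {K : Finset ℤ} {C : Finset (Fin (d + 1) → ℤ)}
    (hK : ∀ x ∈ C, x s ∈ K) (Q : (Fin (d + 1) → ℤ) → Prop) [DecidablePred Q] :
    #{x ∈ C | Q x} = ∑ k ∈ K, #{y ∈ slice s k C | Q (s.insertNth k y)} := by
  rw [card_eq_sum_card_fiberwise (f := fun x => x s) (t := K)
    (fun x hx => hK x (mem_filter.1 hx).1)]
  refine sum_congr rfl fun k _ => ?_
  symm
  refine card_bij (fun y _ => s.insertNth k y) ?_ ?_ ?_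
  · intro y hy
    rw [mem_filter, mem_slice] at hy
    simp [hy]
  · intro y _ y' _ h
    exact (Fin.insertNth_injective2 h).2
  · intro x hx
    simp only [mem_filter] at hx
    obtain ⟨⟨hx, hQ⟩, rfl⟩ := hx
    refine ⟨s.removeNth x, ?_, by simp⟩
    rw [mem_filter, mem_slice]
    simp [hx, hQ]

theorem card_eq_sum_slice {s : Fin (d + 1)} {K : Finset ℤ} {C : Finset (Fin (d + 1) → ℤ)}
    (hK : ∀ x ∈ C, x s ∈ K) : #C = ∑ k ∈ K, #(slice s k C) := by
  simpa using card_filter_eq_sum_slice hK fun _ => True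

theorem insertNth_add_single_self (s : Fin (d + 1)) (k ε : ℤ) (y : Fin d → ℤ) :
    (s.insertNth k y + Pi.single s ε : Fin (d + 1) → ℤ) = s.insertNth (k + ε) y := by
  ext i
  refine Fin.succAboveCases s ?_ (fun j => ?_) i <;> simp

theorem insertNth_add_single_succAbove (s : Fin (d + 1)) (i : Fin d) (k ε : ℤ) (y : Fin d → ℤ) :
    (s.insertNth k y + Pi.single (s.succAbove i) ε : Fin (d + 1) → ℤ) =
      s.insertNth k (y + Pi.single i ε) := by
  ext l
  refine Fin.succAboveCases s ?_ (fun j => ?_) l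
  · simp [(Fin.succAbove_ne s i).symm]
  · simp [Pi.single_apply]

/-- The edge perimeter in terms of parallel sections. -/
theorem perimeter_eq_sum_slice {s : Fin (d + 1)} {K : Finset ℤ} {C : Finset (Fin (d + 1) → ℤ)}
    (hK : ∀ x ∈ C, x s ∈ K) :
    perimeter C = ∑ k ∈ K, (perimeter (slice s k C) + #(slice s k C \ slice s (k + 1) C) +
      #(slice s k C \ slice s (k - 1) C)) := by
  have hs : ∀ ε : ℤ, #{x ∈ C | x + Pi.single s ε ∉ C} =
      ∑ k ∈ K, #(slice s k C \ slice s (k + ε) C) := by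
    intro ε
    rw [card_filter_eq_sum_slice hK]
    refine sum_congr rfl fun k _ => ?_
    congr 1
    ext y
    rw [mem_filter, mem_sdiff, insertNth_add_single_self, mem_slice (k := k + ε)]
  have hi : ∀ (i : Fin d) (ε : ℤ), #{x ∈ C | x + Pi.single (s.succAbove i) ε ∉ C} =
      ∑ k ∈ K, #{y ∈ slice s k C | y + Pi.single i ε ∉ slice s k C} := by
    intro i ε
    rw [card_filter_eq_sum_slice hK]
    refine sum_congr rfl fun k _ => ?_
    congr 1
    ext y
    rw [mem_filter, mem_filter, insertNth_add_single_succAbove, mem_slice (y := y + _)]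
  rw [perimeter, Fin.sum_univ_succAbove _ s]
  simp only [hs, hi, ← sum_add_distrib]
  rw [sum_comm, ← sum_add_distrib]
  refine sum_congr rfl fun k _ => ?_
  simp only [perimeter, sub_eq_add_neg]
  ring

/-- Attaching a layer to a larger facet adds the perimeter of the layer. -/
theorem perimeter_attach {s : Fin (d + 1)} {C D : Finset (Fin (d + 1) → ℤ)}
    {T : Finset (Fin d → ℤ)} {k : ℤ} (hD : ∀ l ≠ k, slice s l D = slice s l C)
    (hDk : slice s k D = T) (hk : ∀ l, k ≤ l → slice s l C = ∅) (hT : T ⊆ slice s (k - 1) C) :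
    perimeter D = perimeter C + perimeter T := by
  obtain ⟨K, hKC, hKD, hk0, hk1⟩ : ∃ K : Finset ℤ, (∀ x ∈ C, x s ∈ K) ∧ (∀ x ∈ D, x s ∈ K) ∧
      k ∈ K ∧ k - 1 ∈ K.erase k := by
    refine ⟨C.image (· s) ∪ D.image (· s) ∪ {k, k - 1}, ?_, ?_, ?_, ?_⟩
    · intro x hx; simp only [mem_union, mem_image]; exact Or.inl (Or.inl ⟨x, hx, rfl⟩)
    · intro x hx; simp only [mem_union, mem_image]; exact Or.inl (Or.inr ⟨x, hx, rfl⟩)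
    · simp
    · simp
  rw [perimeter_eq_sum_slice hKC, perimeter_eq_sum_slice hKD]
  rw [← add_sum_erase _ _ hk0, ← add_sum_erase _ _ hk1, ← add_sum_erase K _ hk0,
    ← add_sum_erase _ _ hk1]
  have hrest : ∀ l ∈ (K.erase k).erase (k - 1),
      perimeter (slice s l D) + #(slice s l D \ slice s (l + 1) D) +
        #(slice s l D \ slice s (l - 1) D) =
      perimeter (slice s l C) + #(slice s l C \ slice s (l + 1) C) +
        #(slice s l C \ slice s (l - 1) C) := by
    intro l hl
    simp only [mem_erase] at hl
    rw [hD l hl.2.1, hD (l + 1) (by omega)]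
    by_cases hlk : l = k + 1
    · rw [hk l (by omega)]; simp
    · rw [hD (l - 1) (by omega)]
  rw [sum_congr rfl hrest]
  rw [hDk, hD (k + 1) (by omega), hD (k - 1) (by omega), hk k le_rfl, hk (k + 1) (by omega),
    sub_add_cancel, hDk, hk k le_rfl, hD (k - 1 - 1) (by omega)]
  -- Normal to the layer the balance is zero: T covers #T boundary edges of the facet and exposes #T
  -- new ones.
  have hTe : T \ slice s (k - 1) C = ∅ := sdiff_eq_empty_iff_subset.2 hT
  have hTc := card_sdiff_add_card_eq_card hT
  rw [hTe]
  simp only [sdiff_empty, empty_sdiff, card_empty, perimeter_empty]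
  omega

/-- Deleting a section and closing the gap decreases the perimeter at least by that of the
section. -/
theorem exists_perimeter_add_slice_le (s : Fin (d + 1)) (C : Finset (Fin (d + 1) → ℤ)) (k : ℤ) :
    ∃ D : Finset (Fin (d + 1) → ℤ), #D + #(slice s k C) = #C ∧
      perimeter D + perimeter (slice s k C) ≤ perimeter C := by
  -- `φ` enumerates the levels other than k, so that levels k - 1 and k + 1 become adjacent.
  let φ : ℤ → ℤ := fun j => if j < k then j else j + 1
  have hφ : Function.Injective φ := by
    intro i j h
    simp only [φ] at h
    split_ifs at h <;> omega
  have hφr : ∀ l, l ≠ k → l ∈ Set.range φ := by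
    intro l hl
    rcases lt_or_gt_of_ne hl with h | h
    · exact ⟨l, by simp [φ, h]⟩
    · exact ⟨l - 1, by simp only [φ]; rw [if_neg (by omega)]; omega⟩
  let K : Finset ℤ := insert k (C.image (· s))
  have hK : ∀ x ∈ C, x s ∈ K := fun x hx =>
    mem_insert_of_mem (mem_image_of_mem (fun x : Fin (d + 1) → ℤ => x s) hx)
  have hkK : k ∈ K := mem_insert_self _ _
  let K' : Finset ℤ := (K.erase k).preimage φ hφ.injOn
  have hsum : ∀ f : ℤ → ℕ, ∑ j ∈ K', f (φ j) = ∑ l ∈ K.erase k, f l := fun f =>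
    sum_preimage φ _ hφ.injOn f fun l hl hlr => absurd (hφr l (mem_erase.1 hl).1) hlr
  have hA : ∀ j ∉ K', slice s (φ j) C = ∅ := by
    intro j hj
    refine slice_eq_empty hK fun h => hj ?_
    simp only [K', mem_preimage, mem_erase]
    refine ⟨?_, h⟩
    simp only [φ]
    split_ifs <;> omega
  let D := ofSlices s K' fun j => slice s (φ j) C
  have hD : ∀ j, slice s j D = slice s (φ j) C := slice_ofSlices_of_forall hA
  have hDK : ∀ x ∈ D, x s ∈ K' := fun x hx => apply_mem_of_mem_ofSlices hx
  refine ⟨D, ?_, ?_⟩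
  · rw [card_eq_sum_slice hDK, card_eq_sum_slice hK, ← sum_erase_add _ _ hkK,
      ← hsum fun l => #(slice s l C)]
    simp only [hD]
  · rw [perimeter_eq_sum_slice hDK, perimeter_eq_sum_slice hK, ← sum_erase_add _ _ hkK]
    simp only [hD]
    -- Only the two sections flanking the gap change neighbours. The triangle inequality through
    -- section k bounds their new boundary, paid for by the normal boundary of section k itself.
    have hle : ∀ j ∈ K', perimeter (slice s (φ j) C) +
        #(slice s (φ j) C \ slice s (φ (j + 1)) C) +
        #(slice s (φ j) C \ slice s (φ (j - 1)) C) ≤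
        (perimeter (slice s (φ j) C) + #(slice s (φ j) C \ slice s (φ j + 1) C) +
          #(slice s (φ j) C \ slice s (φ j - 1) C)) +
        ((if j = k - 1 then #(slice s k C \ slice s (k + 1) C) else 0) +
          if j = k then #(slice s k C \ slice s (k - 1) C) else 0) := by
      intro j _
      have tri : ∀ X Y Z : Finset (Fin d → ℤ), #(X \ Z) ≤ #(X \ Y) + #(Y \ Z) := fun X Y Z =>
        (card_le_card (sdiff_triangle X Y Z)).trans (card_union_le _ _)
      have h1 : #(slice s (φ j) C \ slice s (φ (j + 1)) C) ≤
          #(slice s (φ j) C \ slice s (φ j + 1) C) +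
          if j = k - 1 then #(slice s k C \ slice s (k + 1) C) else 0 := by
        by_cases hj : j = k - 1
        · have e1 : φ j + 1 = k := by simp only [φ]; rw [if_pos (by omega)]; omega
          have e2 : φ (j + 1) = k + 1 := by simp only [φ]; rw [if_neg (by omega)]; omega
          rw [if_pos hj, e1, e2]
          exact tri _ _ _
        · have e : φ (j + 1) = φ j + 1 := by simp only [φ]; split_ifs <;> omega
          rw [if_neg hj, e, add_zero]
      have h2 : #(slice s (φ j) C \ slice s (φ (j - 1)) C) ≤
          #(slice s (φ j) C \ slice s (φ j - 1) C) +
          if j = k then #(slice s k C \ slice s (k - 1) C) else 0 := by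
        by_cases hj : j = k
        · have e1 : φ j - 1 = k := by simp only [φ]; rw [if_neg (by omega)]; omega
          have e2 : φ (j - 1) = k - 1 := by simp only [φ]; rw [if_pos (by omega)]; omega
          rw [if_pos hj, e1, e2]
          exact tri _ _ _
        · have e : φ (j - 1) = φ j - 1 := by simp only [φ]; split_ifs <;> omega
          rw [if_neg hj, e, add_zero]
      omega
    have h := (sum_le_sum hle).trans_eq sum_add_distrib
    rw [hsum fun l => perimeter (slice s l C) +
      #(slice s l C \ slice s (l + 1) C) + #(slice s l C \ slice s (l - 1) C),
      sum_add_distrib (f := fun j => if j = k - 1 then _ else 0), sum_ite_eq', sum_ite_eq'] at h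
    have h3 : (if k - 1 ∈ K' then #(slice s k C \ slice s (k + 1) C) else 0) ≤
      #(slice s k C \ slice s (k + 1) C) := by split_ifs <;> simp
    have h4 : (if k ∈ K' then #(slice s k C \ slice s (k - 1) C) else 0) ≤
      #(slice s k C \ slice s (k - 1) C) := by split_ifs <;> simp
    omega

/-! ### Quasi-cubes and layers as sets -/

/-- The quasi-cube whose first `j` sides have length `a + 1` and whose other sides have
length `a`. -/
noncomputable def box (d a j : ℕ) : Finset (Fin d → ℤ) :=
  Fintype.piFinset fun i => Ico 0 (if (i : ℕ) < j then (a : ℤ) + 1 else a)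

theorem mem_box {d a j : ℕ} {x : Fin d → ℤ} :
    x ∈ box d a j ↔ ∀ i, 0 ≤ x i ∧ x i < if (i : ℕ) < j then (a : ℤ) + 1 else a := by
  simp [box]

theorem box_self (d a : ℕ) : box d a d = box d (a + 1) 0 := by
  ext x; simp [mem_box]

theorem box_one_zero (d : ℕ) : box d 1 0 = {0} := by
  ext x
  simp only [mem_box, mem_singleton, funext_iff, Pi.zero_apply]
  refine forall_congr' fun i => ?_
  simp; omega

theorem val_succAbove_lt_iff {d j : ℕ} (hj : j < d + 1) (i : Fin d) :
    (((⟨j, hj⟩ : Fin (d + 1)).succAbove i : Fin (d + 1)) : ℕ) < j ↔ (i : ℕ) < j := by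
  rw [Fin.succAbove]
  split_ifs with h
  · simp
  · simp [Fin.lt_def] at h ⊢; omega

theorem val_succAbove_lt_succ_iff {d j : ℕ} (hj : j < d + 1) (i : Fin d) :
    (((⟨j, hj⟩ : Fin (d + 1)).succAbove i : Fin (d + 1)) : ℕ) < j + 1 ↔ (i : ℕ) < j := by
  rw [Fin.succAbove]
  split_ifs with h
  · simp [Fin.lt_def] at h ⊢; omega
  · simp

theorem insertNth_mem_box {d a j : ℕ} (hj : j < d + 1) {k : ℤ} {y : Fin d → ℤ} :
    ((⟨j, hj⟩ : Fin (d + 1)).insertNth k y : Fin (d + 1) → ℤ) ∈ box (d + 1) a j ↔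
      (0 ≤ k ∧ k < a) ∧ y ∈ box d a j := by
  simp only [mem_box, Fin.forall_iff_succAbove (⟨j, hj⟩ : Fin (d + 1)), Fin.insertNth_apply_same,
    Fin.insertNth_apply_succAbove, val_succAbove_lt_iff, lt_irrefl, if_false]

theorem insertNth_mem_box_succ {d a j : ℕ} (hj : j < d + 1) {k : ℤ} {y : Fin d → ℤ} :
    ((⟨j, hj⟩ : Fin (d + 1)).insertNth k y : Fin (d + 1) → ℤ) ∈ box (d + 1) a (j + 1) ↔
      (0 ≤ k ∧ k < a + 1) ∧ y ∈ box d a j := by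
  simp only [mem_box, Fin.forall_iff_succAbove (⟨j, hj⟩ : Fin (d + 1)), Fin.insertNth_apply_same,
    Fin.insertNth_apply_succAbove, val_succAbove_lt_succ_iff, Nat.lt_succ_self, if_true]

/-- The quasi-cube `box (d + 1) a j` together with the layer `T` on top of its `j`-th facet. -/
noncomputable def addLayer {d : ℕ} (a j : ℕ) (T : Finset (Fin d → ℤ)) : Finset (Fin (d + 1) → ℤ) :=
  box (d + 1) a j ∪ T.image fun y => (Fin.ofNat (d + 1) j).insertNth (a : ℤ) y

/-- `addLayer` takes its direction modulo d + 1 to avoid carrying a proof of j ≤ d; in that range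
nothing is reduced. -/
theorem ofNat_eq_mk {d j : ℕ} (hj : j ≤ d) :
    Fin.ofNat (d + 1) j = ⟨j, Nat.lt_succ_of_le hj⟩ :=
  Fin.ext (Nat.mod_eq_of_lt (Nat.lt_succ_of_le hj))

theorem insertNth_mem_addLayer {d a j : ℕ} (hj : j ≤ d) {T : Finset (Fin d → ℤ)} {k : ℤ}
    {y : Fin d → ℤ} :
    ((⟨j, Nat.lt_succ_of_le hj⟩ : Fin (d + 1)).insertNth k y : Fin (d + 1) → ℤ) ∈
      addLayer a j T ↔ ((0 ≤ k ∧ k < a) ∧ y ∈ box d a j) ∨ (k = a ∧ y ∈ T) := by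
  rw [addLayer, mem_union, insertNth_mem_box, mem_image, ofNat_eq_mk hj]
  refine or_congr_right ⟨?_, ?_⟩
  · rintro ⟨y', hy', h⟩
    obtain ⟨rfl, rfl⟩ := Fin.insertNth_injective2 h
    exact ⟨rfl, hy'⟩
  · rintro ⟨rfl, hy⟩
    exact ⟨y, hy, rfl⟩

theorem addLayer_empty {d : ℕ} (a j : ℕ) :
    addLayer a j (∅ : Finset (Fin d → ℤ)) = box (d + 1) a j := by
  simp [addLayer]

theorem addLayer_box {d a j : ℕ} (hj : j ≤ d) :
    addLayer a j (box d a j) = box (d + 1) a (j + 1) := by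
  ext x
  rw [← Fin.insertNth_self_removeNth (⟨j, Nat.lt_succ_of_le hj⟩ : Fin (d + 1)) x,
    insertNth_mem_addLayer hj, insertNth_mem_box_succ]
  constructor
  · rintro (⟨h, h'⟩ | ⟨h, h'⟩)
    · exact ⟨by omega, h'⟩
    · exact ⟨by omega, h'⟩
  · rintro ⟨h, h'⟩
    by_cases hx : x ⟨j, Nat.lt_succ_of_le hj⟩ = a
    · exact Or.inr ⟨hx, h'⟩
    · exact Or.inl ⟨by omega, h'⟩

theorem addLayer_mono {d a j : ℕ} {T U : Finset (Fin d → ℤ)} (h : T ⊆ U) :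
    addLayer a j T ⊆ addLayer a j U :=
  union_subset_union_right (image_subset_image h)

theorem card_box {d a j : ℕ} (hj : j ≤ d) : #(box d a j) = boxCard d a j := by
  rw [box, Fintype.card_piFinset]
  have h : ∀ i : Fin d, #(Ico (0 : ℤ) (if (i : ℕ) < j then (a : ℤ) + 1 else a)) =
      if (i : ℕ) < j then a + 1 else a := by
    intro i
    split_ifs <;> simp
  rw [prod_congr rfl fun i _ => h i,
    Fin.prod_univ_eq_prod_range (fun i => if i < j then a + 1 else a), prod_ite, prod_const, prod_const, boxCard, mul_comm]
  have e1 : (range d).filter (· < j) = range j := by ext i; simp; omega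
  have e2 : (range d).filter (¬ · < j) = Ico j d := by ext i; simp; omega
  rw [e1, e2, card_range, Nat.card_Ico]

theorem card_addLayer {d a j : ℕ} (hj : j ≤ d) (T : Finset (Fin d → ℤ)) :
    #(addLayer a j T) = boxCard (d + 1) a j + #T := by
  rw [addLayer, card_union_of_disjoint, card_box (by omega),
    card_image_of_injective _ (Fin.insertNth_right_injective _)]
  rw [disjoint_left]
  intro x hx hx'
  obtain ⟨y, -, rfl⟩ := mem_image.1 hx'
  rw [ofNat_eq_mk hj, insertNth_mem_box] at hx
  omega

theorem perimeter_addLayer {d a j : ℕ} (ha : 1 ≤ a) (hj : j ≤ d) {T : Finset (Fin d → ℤ)}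
    (hT : T ⊆ box d a j) :
    perimeter (addLayer a j T) = perimeter (box (d + 1) a j) + perimeter T := by
  refine perimeter_attach (s := ⟨j, Nat.lt_succ_of_le hj⟩) (k := a) ?_ ?_ ?_ ?_
  · intro l hl
    ext y
    rw [mem_slice, mem_slice, insertNth_mem_addLayer hj, insertNth_mem_box]
    simp [hl]
  · ext y
    rw [mem_slice, insertNth_mem_addLayer hj]
    simp
  · intro l hl
    ext y
    rw [mem_slice, insertNth_mem_box]
    simp only [notMem_empty, iff_false]
    omega
  · intro y hy
    rw [mem_slice, insertNth_mem_box]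
    exact ⟨by omega, hT hy⟩

/-! ### The nested chain -/

open Classical in
/-- A nested family of sets in `ℤ^d`, the `n`-th of which has `n` points. Each is a quasi-cube
together with a member of the family of `ℤ^(d-1)` on top of one of its facets. -/
noncomputable def chain : (d : ℕ) → ℕ → Finset (Fin d → ℤ)
  | 0, n => if n = 0 then ∅ else univ
  | d + 1, n =>
    if h : 2 ≤ n then
      addLayer (exists_stage d h).choose (exists_stage d h).choose_spec.choose
        (chain d (exists_stage d h).choose_spec.choose_spec.choose)
    else if n = 0 then ∅ else box (d + 1) 1 0

theorem chain_zero_right (d : ℕ) : chain d 0 = ∅ := by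
  cases d <;> simp [chain]

theorem chain_one_right (d : ℕ) : chain d 1 = {0} := by
  cases d with
  | zero =>
    rw [chain, if_neg one_ne_zero]
    exact eq_singleton_iff_unique_mem.2 ⟨mem_univ _, fun x _ => Subsingleton.elim x 0⟩
  | succ d => simp [chain, box_one_zero]

theorem chain_layer_of_pos {d a j t : ℕ} (ha : 1 ≤ a) (hj : j ≤ d) (ht : 0 < t)
    (htF : t ≤ boxCard d a j) :
    chain (d + 1) (boxCard (d + 1) a j + t) = addLayer a j (chain d t) := by
  have h : 2 ≤ boxCard (d + 1) a j + t := by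
    have := boxCard_pos (d := d + 1) (j := j) ha
    omega
  rw [chain, dif_pos h]
  obtain ⟨-, hj', ht', htF', e⟩ := (exists_stage d h).choose_spec.choose_spec.choose_spec
  obtain ⟨e1, e2, e3⟩ := stage_unique hj hj' ht ht' htF htF' e
  have congr_stage : ∀ a' j' t', a = a' → j = j' → t = t' →
      addLayer a' j' (chain d t') = addLayer a j (chain d t) := by
    rintro _ _ _ rfl rfl rfl
    rfl
  exact congr_stage _ _ _ e1 e2 e3

/-- A completed quasi-cube is reached at the end of the preceding stage, not at the start of its
own; both descriptions give the same set, by `box_self` when the side length increases. -/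
theorem chain_boxCard {d a j : ℕ} (ha : 1 ≤ a) (hj : j ≤ d) :
    chain d (boxCard d a j) = box d a j := by
  induction d generalizing a j with
  | zero =>
    obtain rfl : j = 0 := by omega
    have h : boxCard 0 a 0 = 1 := by simp [boxCard]
    rw [h, chain_one_right]
    ext x
    simp [mem_box, Subsingleton.elim x 0]
  | succ d ih =>
    by_cases h1 : a = 1 ∧ j = 0
    · obtain ⟨rfl, rfl⟩ := h1
      have h : boxCard (d + 1) 1 0 = 1 := by simp [boxCard]
      rw [h, chain_one_right, box_one_zero]
    · obtain ⟨a', j', ha', hj', hcase, e⟩ := exists_boxCard_pred ha hj h1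
      rw [e, boxCard_succ_succ hj', chain_layer_of_pos ha' hj' (boxCard_pos ha') le_rfl, ih ha' hj',
        addLayer_box hj']
      rcases hcase with ⟨rfl, rfl⟩ | ⟨rfl, rfl, rfl⟩
      · rfl
      · exact box_self _ _

theorem chain_layer {d a j t : ℕ} (ha : 1 ≤ a) (hj : j ≤ d) (htF : t ≤ boxCard d a j) :
    chain (d + 1) (boxCard (d + 1) a j + t) = addLayer a j (chain d t) := by
  rcases Nat.eq_zero_or_pos t with rfl | ht
  · rw [add_zero, chain_boxCard ha (by omega), chain_zero_right, addLayer_empty]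
  · exact chain_layer_of_pos ha hj ht htF

theorem chain_mono (d : ℕ) : Monotone (chain d) := by
  induction d with
  | zero =>
    refine monotone_nat_of_le_succ fun n => ?_
    simp only [chain, Nat.succ_ne_zero, if_false]
    exact subset_univ _
  | succ d ih =>
    refine monotone_nat_of_le_succ fun n => ?_
    rcases Nat.eq_zero_or_pos n with rfl | hn
    · rw [chain_zero_right]; exact empty_subset _
    · obtain ⟨a, j, t, ha, hj, ht, htF, e⟩ := exists_stage d (n := n + 1) (by omega)
      obtain ⟨u, rfl⟩ : ∃ u, t = u + 1 := ⟨t - 1, by omega⟩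
      obtain rfl : n = boxCard (d + 1) a j + u := by omega
      rw [e, chain_layer ha hj htF, chain_layer ha hj (by omega)]
      exact addLayer_mono (ih (Nat.le_succ u))

/-- The restriction is needed because ℤ^0 has one point and the chain is constant there from n = 1
on. -/
theorem card_chain {d n : ℕ} (h : d = 0 → n ≤ 1) : #(chain d n) = n := by
  induction d generalizing n with
  | zero =>
    obtain rfl | rfl : n = 0 ∨ n = 1 := by have := h rfl; omega
    · rw [chain_zero_right, card_empty]
    · rw [chain_one_right, card_singleton]
  | succ d ih =>
    rcases Nat.lt_or_ge n 2 with h2 | h2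
    · obtain rfl | rfl : n = 0 ∨ n = 1 := by omega
      · rw [chain_zero_right, card_empty]
      · rw [chain_one_right, card_singleton]
    · obtain ⟨a, j, t, ha, hj, ht, htF, rfl⟩ := exists_stage d h2
      rw [chain_layer ha hj htF, card_addLayer hj, ih]
      rintro rfl
      obtain rfl : j = 0 := by omega
      simpa [boxCard] using htF

theorem layerRecursion_perimeter_chain : LayerRecursion fun d n => perimeter (chain d n) where
  zero_left n := by simp [perimeter]
  zero_right d := by rw [chain_zero_right, perimeter_empty]
  one_right d := by rw [chain_one_right, chain_one_right, perimeter_singleton,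
    perimeter_singleton]; ring
  layer d a j t ha hj ht := by
    have hsub : chain d t ⊆ box d a j := chain_boxCard ha hj ▸ chain_mono d ht
    rw [chain_layer ha hj ht, perimeter_addLayer ha hj hsub, chain_boxCard ha (by omega)]

/-! ### Minimality of the chain -/

/-- A finite set of more than `a ^ d` points has more than `a` nonempty sections in some
direction. -/
theorem exists_lt_card_image {d a : ℕ} {C : Finset (Fin d → ℤ)} (h : a ^ d < #C) :
    ∃ s, a < #(C.image (· s)) := by
  by_contra! hcon
  have hsub : C ⊆ Fintype.piFinset fun s => C.image (· s) := fun x hx =>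
    Fintype.mem_piFinset.2 fun s => mem_image_of_mem (fun x : Fin d → ℤ => x s) hx
  have h1 := card_le_card hsub
  rw [Fintype.card_piFinset] at h1
  have h2 : ∏ s, #(C.image (· s)) ≤ ∏ _s : Fin d, a := prod_le_prod' fun s _ => hcon s
  rw [prod_const, card_univ, Fintype.card_fin] at h2
  omega

/-- The smallest nonempty section is at most the average one. Its nonemptiness makes the induction
on the size progress. -/
theorem exists_slice_card_mul_le {d a : ℕ} {C : Finset (Fin (d + 1) → ℤ)} {s : Fin (d + 1)}
    (h : a < #(C.image (· s))) :
    ∃ k, 0 < #(slice s k C) ∧ (a + 1) * #(slice s k C) ≤ #C := by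
  obtain ⟨k, hk, hmin⟩ := exists_min_image (C.image (· s)) (fun k => #(slice s k C))
    (card_pos.1 (by omega))
  refine ⟨k, ?_, ?_⟩
  · obtain ⟨x, hx, rfl⟩ := mem_image.1 hk
    exact card_pos.2 ⟨s.removeNth x, mem_slice.2 (by simpa using hx)⟩
  · rw [card_eq_sum_slice (s := s) (K := C.image (· s))
      fun x hx => mem_image_of_mem (fun x : Fin (d + 1) → ℤ => x s) hx]
    calc (a + 1) * #(slice s k C) ≤ #(C.image (· s)) • #(slice s k C) := by
          rw [smul_eq_mul]; gcongr; exact h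
      _ ≤ _ := card_nsmul_le_sum _ _ _ hmin

/-- The members of `chain d` have minimal perimeter. -/
theorem perimeter_chain_le (d : ℕ) (C : Finset (Fin d → ℤ)) :
    perimeter (chain d #C) ≤ perimeter C := by
  induction d with
  | zero => simp [perimeter]
  | succ d ihd =>
    induction hn : #C using Nat.strong_induction_on generalizing C with
    | _ n ih =>
    rcases Nat.lt_or_ge n 2 with h2 | h2
    · obtain rfl | rfl : n = 0 ∨ n = 1 := by omega
      · rw [chain_zero_right, perimeter_empty]; exact Nat.zero_le _
      · obtain ⟨x, rfl⟩ := card_eq_one.1 hn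
        rw [chain_one_right, perimeter_singleton, perimeter_singleton]
    · obtain ⟨a, j, t, ha, hj, ht, htF, e⟩ := exists_stage d h2
      have hlow : a ^ (d + 1) < #C := by
        have := pow_le_boxCard (d := d + 1) (a := a) (j := j) (by omega)
        omega
      have hupp : n ≤ (a + 1) ^ (d + 1) := by
        have h3 := boxCard_succ_succ (a := a) hj
        have h4 := boxCard_le_succ_pow (d := d + 1) (a := a) (j := j + 1) (by omega)
        omega
      obtain ⟨s, hs⟩ := exists_lt_card_image hlow
      obtain ⟨k, hpos, hk⟩ := exists_slice_card_mul_le hs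
      obtain ⟨D, hDc, hDp⟩ := exists_perimeter_add_slice_le s C k
      have h5 := layerRecursion_perimeter_chain.le_split d ha hupp (hn ▸ hk)
      have h6 := ih #D (by omega) D rfl
      have h7 := ihd (slice s k C)
      have e2 : n - #(slice s k C) = #D := by omega
      simp only [e2] at h5
      omega

/-! ### Compression of sections -/

/-- By nestedness the left side is the truncated difference #A - #B, the least possible for sets of
these sizes. -/
theorem card_sdiff_chain_le {d : ℕ} (A B : Finset (Fin d → ℤ)) :
    #(chain d #A \ chain d #B) ≤ #(A \ B) := by
  have hcard : ∀ X : Finset (Fin d → ℤ), #(chain d #X) = #X := fun X => card_chain fun h => by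
    subst h
    exact (card_le_univ X).trans (by simp)
  rcases le_total #A #B with h | h
  · rw [sdiff_eq_empty_iff_subset.2 (chain_mono d h), card_empty]
    exact Nat.zero_le _
  · rw [card_sdiff_of_subset (chain_mono d h), hcard, hcard]
    exact le_card_sdiff B A

theorem EIP_card {d : ℕ} (C : Finset (Fin d → ℤ)) : EIP d #C = perimeter (chain d #C) := by
  have hcard : #(chain d #C) = #C := card_chain fun h => by
    subst h
    exact (card_le_univ C).trans (by simp)
  refine le_antisymm (Nat.sInf_le ⟨chain d #C, finite_toSet _, ?_, edgePerimeter_coe _⟩) ?_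
  · rw [Set.ncard_coe_finset, hcard]
  · refine le_csInf ⟨_, C, finite_toSet _, Set.ncard_coe_finset _, rfl⟩ ?_
    rintro m ⟨D, hD, hDc, rfl⟩
    lift D to Finset (Fin d → ℤ) using hD
    rw [Set.ncard_coe_finset] at hDc
    rw [edgePerimeter_coe, ← hDc]
    exact perimeter_chain_le d D

theorem coe_slice {d : ℕ} (s : Fin (d + 1)) (k : ℤ) (C : Finset (Fin (d + 1) → ℤ)) :
    (slice s k C : Set (Fin d → ℤ)) = dropCoord s '' latticeSection C s k := by
  ext y
  simp only [slice, coe_image, coe_filter, latticeSection]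
  rfl

/-- The sections of a set of minimal perimeter have minimal perimeter. -/
theorem perimeter_slice_eq {d : ℕ} {C : Finset (Fin (d + 1) → ℤ)}
    (hC : perimeter C = perimeter (chain (d + 1) #C)) (s : Fin (d + 1)) (k : ℤ) :
    perimeter (slice s k C) = perimeter (chain d #(slice s k C)) := by
  let K := C.image (· s)
  have hK : ∀ x ∈ C, x s ∈ K := fun x hx =>
    mem_image_of_mem (fun x : Fin (d + 1) → ℤ => x s) hx
  by_cases hk : k ∉ K
  · rw [slice_eq_empty hK hk, card_empty, chain_zero_right]
  rw [not_not] at hk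
  let D := ofSlices s K fun l => chain d #(slice s l C)
  have hD : ∀ l, slice s l D = chain d #(slice s l C) := slice_ofSlices_of_forall fun l hl => by
    rw [slice_eq_empty hK hl, card_empty, chain_zero_right]
  have hDK : ∀ x ∈ D, x s ∈ K := fun x hx => apply_mem_of_mem_ofSlices hx
  have hcard : #D = #C := by
    rw [card_eq_sum_slice hDK, card_eq_sum_slice hK]
    refine sum_congr rfl fun l _ => ?_
    rw [hD]
    exact card_chain fun h => by
      subst h
      exact (card_le_univ _).trans (by simp)
  have hle : perimeter C ≤ perimeter D := by
    rw [hC, ← hcard]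
    exact perimeter_chain_le _ D
  have hterm : ∀ l ∈ K, perimeter (slice s l D) + #(slice s l D \ slice s (l + 1) D) +
      #(slice s l D \ slice s (l - 1) D) ≤ perimeter (slice s l C) +
      #(slice s l C \ slice s (l + 1) C) + #(slice s l C \ slice s (l - 1) C) := by
    intro l _
    simp only [hD]
    exact add_le_add (add_le_add (perimeter_chain_le d _) (card_sdiff_chain_le _ _))
      (card_sdiff_chain_le _ _)
  rw [perimeter_eq_sum_slice hK, perimeter_eq_sum_slice hDK] at hle
  -- Termwise bounds with equal sums are equalities; at level k each of the three summands is then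
  -- an equality too.
  have heq := (sum_eq_sum_iff_of_le hterm).1 (le_antisymm (sum_le_sum hterm) hle) k hk
  simp only [hD] at heq
  have h1 := perimeter_chain_le d (slice s k C)
  have h2 := card_sdiff_chain_le (slice s k C) (slice s (k + 1) C)
  have h3 := card_sdiff_chain_le (slice s k C) (slice s (k - 1) C)
  omega

end EdgeIso

theorem corollary3p3 (d : ℕ) (C : Set (Fin (d + 1) → ℤ)) (hC : EdgeIso.IsEIPMinimizer C)
    (s : Fin (d + 1)) (k : ℤ) :
    EdgeIso.IsEIPMinimizer (EdgeIso.dropCoord s '' EdgeIso.latticeSection C s k) := by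
  rcases hC with rfl | ⟨-, hfin, hmin⟩
  · left
    simp [EdgeIso.latticeSection]
  lift C to Finset (Fin (d + 1) → ℤ) using hfin
  rw [Set.ncard_coe_finset, EdgeIso.edgePerimeter_coe, EdgeIso.EIP_card] at hmin
  rw [← EdgeIso.coe_slice]
  rcases (EdgeIso.slice s k C).eq_empty_or_nonempty with h | h
  · left
    simp [h]
  · right
    refine ⟨h, Finset.finite_toSet _, ?_⟩
    rw [Set.ncard_coe_finset, EdgeIso.edgePerimeter_coe, EdgeIso.EIP_card]
    exact EdgeIso.perimeter_slice_eq hmin s k
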